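/- Let $K\ge 1$, $\mathbf P\in[0,1]^{K\times K}$ with $\operatorname{rank}(\mathbf P)=d$, and let $\rho$ be a vector of $K$ positive numbers with $\sum_i\rho_i=1$. Let $\boldsymbol\nu,\boldsymbol\mu\in\mathbb R^{K\times d}$ (with rows $\nu_i,\mu_i$) satisfy $\boldsymbol\nu\boldsymbol\mu^T=\mathbf P$, and let $\alpha,\beta,\gamma>0$ be such that all eigenvalues of $\boldsymbol\nu^T\boldsymbol\nu$ and of $\boldsymbol\mu^T\boldsymbol\mu$ are greater than $\alpha$; for all $i\ne j$, $\beta<\|\nu_i-\nu_j\|_2$ or $\beta<\|\mu_i-\mu_j\|_2$; and $\gamma<\rho_i$ for all $i$. For every $n\ge1$ let $(\tau^{(n)},\mathbf A^{(n)})$, all defined on one probability space (with no assumption on the joint law for different $n$), be a directed stochastic blockmodel on the nodes $[n]=\{1,\dots,n\}$: the block memberships $\tau^{(n)}(u)\in[K]$, $u\in[n]$, are independent with $\mathbb P[\tau^{(n)}(u)=i]=\rho_i$; $\mathbf A^{(n)}\in\{0,1\}^{n\times n}$ has zero diagonal; and, conditionally on $\tau^{(n)}$, the entries of $\mathbf A^{(n)}$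 are independent, the entry $\mathbf A^{(n)}_{uv}$ with $u\neq v$ being Bernoulli with parameter $\mathbf P_{\tau^{(n)}(u),\tau^{(n)}(v)}$. For $n\ge d$ let $\mathbf A^{(n)}=\tilde{\mathbf U}'\tilde{\boldsymbol\Sigma}'\tilde{\mathbf V}'^T$ be any singular value decomposition ($\tilde{\mathbf U}',\tilde{\mathbf V}'\in\mathbb R^{n\times n}$ orthogonal, $\tilde{\boldsymbol\Sigma}'$ diagonal with nonnegative nonincreasing diagonal), let $\tilde{\mathbf U},\tilde{\mathbf V}\in\mathbb R^{n\times d}$ be the first $d$ columns of $\tilde{\mathbf U}',\tilde{\mathbf V}'$, and let $\tilde{\mathbf W}^{(n)}=[\tilde{\mathbf U}\,|\,\tilde{\mathbf V}]\in\mathbb R^{n\times 2d}$, with rows $\tilde W_u$. Let $\hat\tau^{(n)}:[n]\to[K]$ be the assignment part of any minimizer $(\hat{\boldsymbol\psi},\hat\tau^{(n)})$ of $$\sum_{u=1}^n\|\tilde W_u-\psi_{\tau(u)}\|_2^2$$ over all $\boldsymbol\psi\in\mathbb R^{K\times 2d}$ (with rows $\psi_i$) and all $\tau:[n]\to[K]$.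 Let $\mathcal S_K$ be the set of permutations of $[K]$. Then, with probability $1$, for all but finitely many $n$, $$\min_{\pi\in\mathcal S_K}\bigl|\{u\in[n]:\tau^{(n)}(u)\ne\pi(\hat\tau^{(n)}(u))\}\bigr|\le\frac{2^3\,3^2\,6}{\alpha^5\beta^2\gamma^5}\log n .$$ -/

import Mathlib

open MeasureTheory ProbabilityTheory

/-- `(τ, A)` is a directed stochastic blockmodel on the node set `Fin n`, with block-to-block edge
probabilities `P` and block probabilities `ρ`: the block memberships `τ u` are independent with
law `ρ`; the adjacency matrix `A` has entries in `{0, 1}` and zero diagonal; conditionally on `τ`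
the entries of `A` are independent and, for `u ≠ v`, the entry `A u v` is Bernoulli with
parameter `P (τ u) (τ v)`. -/
structure IsDirectedSBM {Ω : Type*} [MeasurableSpace Ω] (Pr : Measure Ω) {K n : ℕ}
    (P : Matrix (Fin K) (Fin K) ℝ) (ρ : Fin K → ℝ)
    (τ : Ω → Fin n → Fin K) (A : Ω → Matrix (Fin n) (Fin n) ℝ) : Prop where
  measurable_block : ∀ u, Measurable fun ω => τ ω u
  measurable_entry : ∀ u v, Measurable fun ω => A ω u v
  indep_block : iIndepFun (fun u ω => τ ω u) Pr
  law_block : ∀ u i, Pr {ω | τ ω u = i} = ENNReal.ofReal (ρ i)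
  zero_or_one : ∀ ω u v, A ω u v = 0 ∨ A ω u v = 1
  no_loop : ∀ ω u, A ω u u = 0
  cond_indep : ∀ t : Fin n → Fin K, Pr {ω | τ ω = t} ≠ 0 →
    iIndepFun (fun (e : Fin n × Fin n) ω => A ω e.1 e.2) (cond Pr {ω | τ ω = t})
  cond_law : ∀ t : Fin n → Fin K, Pr {ω | τ ω = t} ≠ 0 → ∀ u v, u ≠ v →
    cond Pr {ω | τ ω = t} {ω | A ω u v = 1} = ENNReal.ofReal (P (t u) (t v))

/-- `A = U Σ Vᵀ` is a singular value decomposition: `U`, `V` are orthogonal and `Σ` is diagonal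
with nonnegative, nonincreasing diagonal `σ`. -/
structure IsSVD {n : ℕ} (A U : Matrix (Fin n) (Fin n) ℝ) (σ : Fin n → ℝ)
    (V : Matrix (Fin n) (Fin n) ℝ) : Prop where
  left_orthogonal : U ∈ Matrix.orthogonalGroup (Fin n) ℝ
  right_orthogonal : V ∈ Matrix.orthogonalGroup (Fin n) ℝ
  antitone : Antitone σ
  nonneg : ∀ i, 0 ≤ σ i
  eq_mul : A = U * Matrix.diagonal σ * V.transpose

/-- `(U, V)` is an unscaled adjacency spectral embedding of `A` into dimension `d ≤ n`: the first
`d` columns of the left and right orthogonal factors of a singular value decomposition of `A`. -/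
def IsUnscaledASE {n d : ℕ} (A : Matrix (Fin n) (Fin n) ℝ) (U V : Matrix (Fin n) (Fin d) ℝ) :
    Prop :=
  ∃ (h : d ≤ n) (U' : Matrix (Fin n) (Fin n) ℝ) (σ : Fin n → ℝ) (V' : Matrix (Fin n) (Fin n) ℝ),
    IsSVD A U' σ V' ∧ U = U'.submatrix id (Fin.castLE h) ∧ V = V'.submatrix id (Fin.castLE h)

/-- The Euclidean distance of two real vectors. -/
noncomputable def l2dist {m : Type*} [Fintype m] (x y : m → ℝ) : ℝ :=
  ‖WithLp.toLp 2 x - WithLp.toLp 2 y‖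

/-- The squared error of the assignment `τ` with centroids the rows of `ψ`, for the rows of `Z`. -/
noncomputable def squaredError {n K : ℕ} {m : Type*} [Fintype m] (Z : Matrix (Fin n) m ℝ)
    (ψ : Matrix (Fin K) m ℝ) (τ : Fin n → Fin K) : ℝ :=
  ∑ u, l2dist (Z u) (ψ (τ u)) ^ 2

/-- `τ` is the assignment part of a minimizer of the squared error, over all choices of `K`
centroids and all assignments of the rows of `Z` to them. -/
def IsMSEClustering {n K : ℕ} {m : Type*} [Fintype m] (Z : Matrix (Fin n) m ℝ)
    (τ : Fin n → Fin K) : Prop :=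
  ∃ ψ : Matrix (Fin K) m ℝ, ∀ (ψ' : Matrix (Fin K) m ℝ) (τ' : Fin n → Fin K),
    squaredError Z ψ τ ≤ squaredError Z ψ' τ'

/-- The number of nodes misassigned by `τ'`, minimized over the permutations of the labels. -/
def numMisassigned {n K : ℕ} (τ τ' : Fin n → Fin K) : ℕ :=
  Finset.univ.inf' Finset.univ_nonempty fun π : Equiv.Perm (Fin K) =>
    (Finset.univ.filter fun u => τ u ≠ π (τ' u)).card

open Matrix Filter

/-! Let `X`, `Y` be `ν`, `μ` with rows repeated according to the true blocks, so that `M = X * Yᵀ`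
has entries `P (τ u) (τ v)`. For `i ≠ j` the `(i, j)` entry of `A * Aᵀ` is, given the blocks, a sum
of `n` independent indicators. Hoeffding and Borel–Cantelli therefore give `‖A Aᵀ - M Mᵀ‖_F² ≤ 3 n³
log n` eventually, and likewise for `Aᵀ * A`. Blocks of size at least `γ n` make the squared
singular values of `X` and `Y` at least `a = α γ n`, so the error is of lower order than `a²`.

No eigenspace perturbation theorem is needed. If `U₁` holds the leading left singular vectors and
`S` their squared singular values, then `U₁ = A Aᵀ U₁ S⁻¹ = X B + E U₁ S⁻¹` with `E = A Aᵀ - M Mᵀ`.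
Thus `U₁` is Frobenius-close to `X B`, whose rows take only `K` values, and `B` does not contract
differences of rows of `ν` too much (`IsSVD.exists_approx`). Transposition treats `V`.

Finally, a least-squares clustering can misplace only few points near well-separated centers
(`IsMSEClustering.numMisassigned_le`). The probabilistic event involves only the Gram matrices and
block sizes, so the bound holds for all decompositions and minimizers at once. -/

/-- The Euclidean norm of a real vector. -/
noncomputable def l2norm {m : Type*} [Fintype m] (x : m → ℝ) : ℝ := ‖WithLp.toLp 2 x‖

/-- The squared Frobenius norm of a real matrix. -/
def frobSq {m k : Type*} [Fintype m] [Fintype k] (M : Matrix m k ℝ) : ℝ := ∑ i, ∑ j, M i j ^ 2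

/-! ### Euclidean and Frobenius norms -/

section norms

variable {m k : Type*} [Fintype m] [Fintype k]

lemma l2dist_eq (x y : m → ℝ) : l2dist x y = l2norm (x - y) := rfl

lemma l2norm_nonneg (x : m → ℝ) : 0 ≤ l2norm x := norm_nonneg _

lemma l2norm_sq (x : m → ℝ) : l2norm x ^ 2 = ∑ i, x i ^ 2 := by
  simp [l2norm, EuclideanSpace.real_norm_sq_eq]

lemma l2norm_sq_eq_dotProduct (x : m → ℝ) : l2norm x ^ 2 = x ⬝ᵥ x := by
  rw [l2norm_sq]; simp [dotProduct, sq]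

lemma l2norm_add_le (x y : m → ℝ) : l2norm (x + y) ≤ l2norm x + l2norm y := by
  simpa [l2norm] using norm_add_le (WithLp.toLp 2 x) (WithLp.toLp 2 y)

lemma l2norm_zero : l2norm (0 : m → ℝ) = 0 := by simp [l2norm]

lemma l2norm_neg (x : m → ℝ) : l2norm (-x) = l2norm x := by simp [l2norm]

lemma l2norm_sub_le (x y z : m → ℝ) : l2norm (x - z) ≤ l2norm (x - y) + l2norm (y - z) := by
  simpa using l2norm_add_le (x - y) (y - z)

lemma l2norm_sub_comm (x y : m → ℝ) : l2norm (x - y) = l2norm (y - x) := by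
  rw [← l2norm_neg, neg_sub]

lemma l2norm_eq_zero {x : m → ℝ} : l2norm x = 0 ↔ x = 0 := by simp [l2norm]

lemma dotProduct_le_l2norm (x y : m → ℝ) : x ⬝ᵥ y ≤ l2norm x * l2norm y := by
  have := real_inner_le_norm (WithLp.toLp 2 x) (WithLp.toLp 2 y)
  simpa [l2norm, PiLp.inner_apply, dotProduct, mul_comm] using this

lemma frobSq_eq_sum_row (M : Matrix m k ℝ) : frobSq M = ∑ i, l2norm (fun j => M i j) ^ 2 := by
  simp [frobSq, l2norm_sq]

lemma l2norm_sq_mulVec_le (M : Matrix m k ℝ) (x : k → ℝ) :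
    l2norm (M *ᵥ x) ^ 2 ≤ frobSq M * l2norm x ^ 2 := by
  rw [l2norm_sq, frobSq_eq_sum_row, Finset.sum_mul]
  refine Finset.sum_le_sum fun i _ => ?_
  rw [← mul_pow]
  apply sq_le_sq.2
  rw [abs_of_nonneg (mul_nonneg (l2norm_nonneg _) (l2norm_nonneg x)), abs_le]
  constructor
  · have := dotProduct_le_l2norm (-fun j => M i j) x
    rw [l2norm_neg, neg_dotProduct] at this
    simp only [mulVec]; linarith
  · exact dotProduct_le_l2norm (fun j => M i j) x

lemma frobSq_le_of_mem_Icc (M : Matrix m k ℝ) (hM : ∀ i j, M i j ∈ Set.Icc (0 : ℝ) 1) :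
    frobSq M ≤ Fintype.card m * Fintype.card k := by
  calc frobSq M ≤ ∑ _i : m, ∑ _j : k, (1 : ℝ) :=
        Finset.sum_le_sum fun i _ => Finset.sum_le_sum fun j _ =>
          pow_le_one₀ (hM i j).1 (hM i j).2
    _ = _ := by simp

end norms

/-! ### Singular vectors of a perturbed low-rank matrix -/

lemma l2norm_orthogonal_transpose_mulVec {n : ℕ} {U : Matrix (Fin n) (Fin n) ℝ}
    (hU : U ∈ orthogonalGroup (Fin n) ℝ) (x : Fin n → ℝ) :
    l2norm (Uᵀ *ᵥ x) ^ 2 = l2norm x ^ 2 := by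
  rw [l2norm_sq_eq_dotProduct, l2norm_sq_eq_dotProduct, mulVec_transpose, ← dotProduct_mulVec,
    ← mulVec_transpose, mulVec_mulVec]
  have : U * Uᵀ = 1 := by simpa [star_eq_conjTranspose] using (mem_orthogonalGroup_iff _ _).1 hU
  rw [this, one_mulVec]

/-- Carries every statement about left singular vectors over to right ones. -/
lemma IsSVD.transpose {n : ℕ} {A U V : Matrix (Fin n) (Fin n) ℝ} {σ : Fin n → ℝ}
    (h : IsSVD A U σ V) : IsSVD Aᵀ V σ U where
  left_orthogonal := h.right_orthogonal
  right_orthogonal := h.left_orthogonal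
  antitone := h.antitone
  nonneg := h.nonneg
  eq_mul := by rw [h.eq_mul]; simp [transpose_mul, mul_assoc]

lemma IsSVD.gram_eq {n : ℕ} {A U V : Matrix (Fin n) (Fin n) ℝ} {σ : Fin n → ℝ}
    (h : IsSVD A U σ V) : A * Aᵀ = U * diagonal (fun i => σ i ^ 2) * Uᵀ := by
  have hV : Vᵀ * V = 1 := by
    simpa [star_eq_conjTranspose] using (mem_orthogonalGroup_iff' _ _).1 h.right_orthogonal
  have hd : diagonal (fun i => σ i ^ 2) = diagonal σ * diagonal σ := by
    simp [diagonal_mul_diagonal, sq]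
  rw [h.eq_mul, hd]
  simp only [transpose_mul, transpose_transpose, diagonal_transpose, mul_assoc]
  rw [← mul_assoc Vᵀ V, hV, one_mul]

lemma IsSVD.gram_mul {n : ℕ} {A U V : Matrix (Fin n) (Fin n) ℝ} {σ : Fin n → ℝ}
    (h : IsSVD A U σ V) : A * Aᵀ * U = U * diagonal (fun i => σ i ^ 2) := by
  have hU : Uᵀ * U = 1 := by
    simpa [star_eq_conjTranspose] using (mem_orthogonalGroup_iff' _ _).1 h.left_orthogonal
  rw [h.gram_eq, mul_assoc, hU, mul_one]

/-- A lower bound on the leading singular values of a perturbation of `X * Yᵀ`. -/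
lemma IsSVD.le_sq_of_gram_near {n d : ℕ} (hdn : d ≤ n) {A U V : Matrix (Fin n) (Fin n) ℝ}
    {σ : Fin n → ℝ} (h : IsSVD A U σ V) (X Y : Matrix (Fin n) (Fin d) ℝ) {a e : ℝ} (ha : 0 < a)
    (hX : ∀ y, a * l2norm y ^ 2 ≤ l2norm (X *ᵥ y) ^ 2)
    (hY : ∀ y, a * l2norm y ^ 2 ≤ l2norm (Y *ᵥ y) ^ 2) (he0 : 0 ≤ e)
    (hE : frobSq (A * Aᵀ - X * Yᵀ * (X * Yᵀ)ᵀ) ≤ e ^ 2) (j : Fin d) :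
    a ^ 2 - e ≤ σ (Fin.castLE hdn j) ^ 2 := by
  -- a nonzero vector in the column space of `X`, orthogonal to the first `j` columns of `U`
  obtain ⟨y, hy0, hy⟩ : ∃ y : Fin d → ℝ, y ≠ 0 ∧ ∀ i : Fin n, (i : ℕ) < j → (Uᵀ *ᵥ (X *ᵥ y)) i = 0 := by
    let f : (Fin d → ℝ) →ₗ[ℝ] (Fin j → ℝ) :=
      toLin' ((Uᵀ * X).submatrix (Fin.castLE (j.2.le.trans hdn)) id)
    -- Indices start at 0, so there are `j < d` linear conditions on `d` unknowns.
    have hk : LinearMap.ker f ≠ ⊥ := LinearMap.ker_ne_bot_of_finrank_lt (by simp)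
    obtain ⟨y, hyk, hy0⟩ := Submodule.exists_mem_ne_zero_of_ne_bot hk
    refine ⟨y, hy0, fun i hi => ?_⟩
    have h1 := congrFun (LinearMap.mem_ker.1 hyk) ⟨i, hi⟩
    rw [mulVec_mulVec]
    simpa [f, toLin'_apply, mulVec, dotProduct] using h1
  set x := X *ᵥ y with hx
  have hxpos : 0 < l2norm x ^ 2 := by
    refine lt_of_lt_of_le ?_ (hX y)
    have : l2norm y ≠ 0 := fun h => hy0 (l2norm_eq_zero.1 h)
    positivity
  have hxy : x ⬝ᵥ x = y ⬝ᵥ (Xᵀ *ᵥ x) := by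
    rw [mulVec_transpose, dotProduct_comm y, ← dotProduct_mulVec]
  -- `Xᵀ` inherits the lower bound of `X` on the range of `X`: apply Cauchy–Schwarz to `x ⬝ᵥ x = y
  -- ⬝ᵥ (Xᵀ *ᵥ x)`.
  have h1 : a * l2norm x ^ 2 ≤ l2norm (Xᵀ *ᵥ x) ^ 2 := by
    have hcs : l2norm x ^ 2 ≤ l2norm y * l2norm (Xᵀ *ᵥ x) := by
      rw [l2norm_sq_eq_dotProduct, hxy]; exact dotProduct_le_l2norm _ _
    have h2 : (l2norm x ^ 2) ^ 2 ≤ l2norm y ^ 2 * l2norm (Xᵀ *ᵥ x) ^ 2 := by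
      rw [← mul_pow]; exact pow_le_pow_left₀ hxpos.le hcs 2
    have h3 := hX y
    rw [← hx] at h3
    have h4 : a * (l2norm x ^ 2) ^ 2 ≤ l2norm x ^ 2 * l2norm (Xᵀ *ᵥ x) ^ 2 := by
      calc _ ≤ a * (l2norm y ^ 2 * l2norm (Xᵀ *ᵥ x) ^ 2) := by gcongr
        _ = a * l2norm y ^ 2 * l2norm (Xᵀ *ᵥ x) ^ 2 := by ring
        _ ≤ _ := by gcongr
    nlinarith
  have h2 : a ^ 2 * l2norm x ^ 2 ≤ x ⬝ᵥ ((X * Yᵀ * (X * Yᵀ)ᵀ) *ᵥ x) := by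
    have : x ⬝ᵥ ((X * Yᵀ * (X * Yᵀ)ᵀ) *ᵥ x) = l2norm (Y *ᵥ (Xᵀ *ᵥ x)) ^ 2 := by
      rw [l2norm_sq_eq_dotProduct, ← mulVec_mulVec, dotProduct_mulVec, ← mulVec_transpose]
      simp [transpose_mul, mulVec_mulVec]
    rw [this]
    calc a ^ 2 * l2norm x ^ 2 = a * (a * l2norm x ^ 2) := by ring
      _ ≤ a * l2norm (Xᵀ *ᵥ x) ^ 2 := by gcongr
      _ ≤ _ := hY _
  have h3 : x ⬝ᵥ ((X * Yᵀ * (X * Yᵀ)ᵀ) *ᵥ x) - x ⬝ᵥ ((A * Aᵀ) *ᵥ x) ≤ e * l2norm x ^ 2 := by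
    have heq : x ⬝ᵥ ((X * Yᵀ * (X * Yᵀ)ᵀ) *ᵥ x) - x ⬝ᵥ ((A * Aᵀ) *ᵥ x)
        = (-x) ⬝ᵥ ((A * Aᵀ - X * Yᵀ * (X * Yᵀ)ᵀ) *ᵥ x) := by
      rw [sub_mulVec, dotProduct_sub, neg_dotProduct, neg_dotProduct]; ring
    rw [heq]
    refine (dotProduct_le_l2norm _ _).trans ?_
    rw [l2norm_neg]
    have h5 : l2norm ((A * Aᵀ - X * Yᵀ * (X * Yᵀ)ᵀ) *ᵥ x) ≤ e * l2norm x := by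
      apply le_of_sq_le_sq _ (mul_nonneg he0 (l2norm_nonneg _))
      rw [mul_pow]
      exact (l2norm_sq_mulVec_le _ _).trans (by gcongr)
    nlinarith [l2norm_nonneg x]
  -- The Courant–Fischer argument: in the basis `U`, only coordinates with singular value at most `σ
  -- j` survive.
  have h4 : x ⬝ᵥ ((A * Aᵀ) *ᵥ x) ≤ σ (Fin.castLE hdn j) ^ 2 * l2norm x ^ 2 := by
    rw [h.gram_eq, ← mulVec_mulVec, ← mulVec_mulVec, dotProduct_mulVec, ← mulVec_transpose,
      ← l2norm_orthogonal_transpose_mulVec h.left_orthogonal x, l2norm_sq, Finset.mul_sum, dotProduct]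
    refine Finset.sum_le_sum fun i _ => ?_
    rw [mulVec_diagonal]
    by_cases hij : (i : ℕ) < j
    · simp [hy i hij]
    · have : σ i ≤ σ (Fin.castLE hdn j) := h.antitone (by
        rw [Fin.le_def]; simpa using hij)
      have h6 : σ i ^ 2 ≤ σ (Fin.castLE hdn j) ^ 2 := pow_le_pow_left₀ (h.nonneg i) this 2
      nlinarith [sq_nonneg ((Uᵀ *ᵥ x) i)]
  by_contra! hlt
  nlinarith

/-- Approximation of the leading left singular vectors of a perturbation of `X * Yᵀ` by a linear
image of `X`. -/
lemma IsSVD.exists_approx {n d : ℕ} (hdn : d ≤ n) {A U V : Matrix (Fin n) (Fin n) ℝ}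
    {σ : Fin n → ℝ} (h : IsSVD A U σ V) (X Y : Matrix (Fin n) (Fin d) ℝ) {a e : ℝ} (ha : 0 < a)
    (hX : ∀ y, a * l2norm y ^ 2 ≤ l2norm (X *ᵥ y) ^ 2)
    (hY : ∀ y, a * l2norm y ^ 2 ≤ l2norm (Y *ᵥ y) ^ 2)
    (hM : ∀ u v, (X * Yᵀ) u v ∈ Set.Icc (0 : ℝ) 1) (he0 : 0 ≤ e)
    (hE : frobSq (A * Aᵀ - X * Yᵀ * (X * Yᵀ)ᵀ) ≤ e ^ 2) (he : e ≤ 3 / 16 * a ^ 2) :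
    ∃ B : Matrix (Fin d) (Fin d) ℝ,
      frobSq (U.submatrix id (Fin.castLE hdn) - X * B) ≤ (e / (3 / 4 * a ^ 2)) ^ 2 ∧
      ∀ b, 9 / 16 * (a * l2norm b ^ 2) ≤ (n : ℝ) ^ 2 * l2norm (b ᵥ* B) ^ 2 := by
  -- Since `e ≤ 3 / 16 * a ^ 2`, the bound `a ^ 2 - e` on the squared singular values exceeds `c`,
  -- and `e / c ≤ 1 / 4`.
  set c := 3 / 4 * a ^ 2 with hc
  have hc0 : 0 < c := by positivity
  set M := X * Yᵀ with hMdef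
  set E := A * Aᵀ - M * Mᵀ with hEdef
  set U₁ := U.submatrix id (Fin.castLE hdn) with hU₁
  set s : Fin d → ℝ := fun j => σ (Fin.castLE hdn j) ^ 2 with hs
  have hσ : ∀ j : Fin d, c ≤ s j := fun j => by
    have := h.le_sq_of_gram_near hdn X Y ha hX hY he0 hE j
    nlinarith
  have hs0 : ∀ j, s j ≠ 0 := fun j => (hc0.trans_le (hσ j)).ne'
  have hU₁mul : A * Aᵀ * U₁ = U₁ * diagonal s := by
    have h1 : (A * Aᵀ * U).submatrix id (Fin.castLE hdn) = A * Aᵀ * U₁ := by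
      ext i j; simp [U₁, mul_apply]
    rw [← h1, h.gram_mul]
    ext i j; simp [U₁, s]
  have hF : U₁ - X * (Yᵀ * Mᵀ * U₁ * diagonal fun j => (s j)⁻¹)
      = E * U₁ * diagonal fun j => (s j)⁻¹ := by
    have h1 : diagonal s * (diagonal fun j => (s j)⁻¹) = 1 := by
      rw [diagonal_mul_diagonal]; simp [hs0]
    rw [hEdef, Matrix.sub_mul, hU₁mul, Matrix.sub_mul, Matrix.mul_assoc U₁, h1, Matrix.mul_one]
    simp only [hMdef, Matrix.mul_assoc]
  -- Each row of `E * U₁` consists of `d` of the coordinates of a row of `E` in the orthonormal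
  -- basis `U`.
  have hEU : frobSq (E * U₁) ≤ frobSq E := by
    rw [frobSq_eq_sum_row, frobSq_eq_sum_row]
    refine Finset.sum_le_sum fun i _ => ?_
    rw [← l2norm_orthogonal_transpose_mulVec h.left_orthogonal (fun j => E i j), l2norm_sq, l2norm_sq]
    have : ∀ j, (E * U₁) i j = (Uᵀ *ᵥ fun j => E i j) (Fin.castLE hdn j) := fun j => by
      simp [mul_apply, mulVec, dotProduct, U₁, mul_comm]
    simp_rw [this]
    refine (Finset.sum_map Finset.univ (Fin.castLEEmb hdn)
      fun k => (Uᵀ *ᵥ fun j => E i j) k ^ 2).symm.trans_le ?_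
    exact Finset.sum_le_sum_of_subset_of_nonneg (Finset.subset_univ _) fun _ _ _ => sq_nonneg _
  have hfrob : frobSq (E * U₁ * diagonal fun j => (s j)⁻¹) ≤ (e / c) ^ 2 := by
    calc frobSq (E * U₁ * diagonal fun j => (s j)⁻¹) ≤ frobSq (E * U₁) * (c⁻¹) ^ 2 := by
          simp only [frobSq, Finset.sum_mul]
          refine Finset.sum_le_sum fun i _ => Finset.sum_le_sum fun j _ => ?_
          rw [mul_diagonal, mul_pow]
          have := hσ j
          gcongr
      _ ≤ e ^ 2 * (c⁻¹) ^ 2 := by gcongr; exact hEU.trans hE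
      _ = _ := by rw [div_eq_mul_inv, mul_pow]
  refine ⟨Yᵀ * Mᵀ * U₁ * diagonal fun j => (s j)⁻¹, hF ▸ hfrob, fun b => ?_⟩
  set B := Yᵀ * Mᵀ * U₁ * diagonal fun j => (s j)⁻¹ with hB
  have hU₁iso : ∀ y, l2norm (U₁ *ᵥ y) = l2norm y := fun y => by
    have hU₁U₁ : U₁ᵀ * U₁ = 1 := by
      have hU : Uᵀ * U = 1 := by
        simpa [star_eq_conjTranspose] using (mem_orthogonalGroup_iff' _ _).1 h.left_orthogonal
      ext i j
      have := congrFun (congrFun hU (Fin.castLE hdn i)) (Fin.castLE hdn j)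
      simpa [mul_apply, U₁, one_apply] using this
    rw [← sq_eq_sq₀ (l2norm_nonneg _) (l2norm_nonneg _), l2norm_sq_eq_dotProduct,
      dotProduct_mulVec, ← mulVec_transpose, mulVec_mulVec, hU₁U₁, one_mulVec,
      l2norm_sq_eq_dotProduct]
  -- `U₁` is an isometry and `X * B` is within `1 / 4` of it; in particular the square matrix `B` is
  -- invertible.
  have hXB : ∀ y, 3 / 4 * l2norm y ≤ l2norm (X *ᵥ (B *ᵥ y)) := fun y => by
    have h1 : l2norm ((U₁ - X * B) *ᵥ y) ≤ 1 / 4 * l2norm y := by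
      have hec : e / c ≤ 1 / 4 := by rw [div_le_iff₀ hc0]; rw [hc]; linarith
      have hec0 : 0 ≤ e / c := by positivity
      apply le_of_sq_le_sq _ (mul_nonneg (by norm_num) (l2norm_nonneg _))
      refine (l2norm_sq_mulVec_le _ _).trans ?_
      rw [mul_pow, hF]
      gcongr
      exact hfrob.trans (pow_le_pow_left₀ hec0 hec 2)
    have h2 : l2norm (U₁ *ᵥ y) ≤ l2norm ((U₁ - X * B) *ᵥ y) + l2norm (X *ᵥ (B *ᵥ y)) := by
      rw [mulVec_mulVec]
      convert l2norm_add_le ((U₁ - X * B) *ᵥ y) ((X * B) *ᵥ y) using 2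
      rw [sub_mulVec, sub_add_cancel]
    rw [hU₁iso] at h2
    linarith
  have hBsurj : Function.Surjective (toLin' B) := by
    apply LinearMap.surjective_of_injective
    rw [injective_iff_map_eq_zero]
    intro y hy
    rw [toLin'_apply] at hy
    have := hXB y
    rw [hy, mulVec_zero, l2norm_zero] at this
    exact l2norm_eq_zero.1 (le_antisymm (by linarith) (l2norm_nonneg _))
  set z := Y *ᵥ b with hz
  -- Duality: this `y` turns `z ⬝ᵥ z` into `(b ᵥ* B) ⬝ᵥ y`, while `X *ᵥ (B *ᵥ y) = M *ᵥ z` has norm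
  -- at most `n * l2norm z`, which bounds `y`.
  obtain ⟨y, hy⟩ := hBsurj (Yᵀ *ᵥ z)
  rw [toLin'_apply] at hy
  have h1 : l2norm z ^ 2 ≤ l2norm (b ᵥ* B) * l2norm y := by
    have : z ⬝ᵥ z = (b ᵥ* B) ⬝ᵥ y := by
      rw [← dotProduct_mulVec, hy]
      rw [mulVec_transpose, dotProduct_comm b, ← dotProduct_mulVec]
    rw [l2norm_sq_eq_dotProduct, this]
    exact dotProduct_le_l2norm _ _
  have h2 : 3 / 4 * l2norm y ≤ n * l2norm z := by
    refine (hXB y).trans ?_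
    rw [hy, mulVec_mulVec]
    apply le_of_sq_le_sq _ (mul_nonneg (by positivity) (l2norm_nonneg _))
    refine (l2norm_sq_mulVec_le _ _).trans ?_
    rw [mul_pow]
    gcongr
    refine (frobSq_le_of_mem_Icc _ hM).trans ?_
    simp [sq]
  have h3 : 3 / 4 * l2norm z ≤ n * l2norm (b ᵥ* B) := by
    rcases (l2norm_nonneg z).eq_or_lt with h0 | h0
    · rw [← h0, mul_zero]; exact mul_nonneg (by positivity) (l2norm_nonneg _)
    · have h4 : 3 / 4 * l2norm z ^ 2 ≤ l2norm (b ᵥ* B) * (n * l2norm z) := by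
        nlinarith [l2norm_nonneg (b ᵥ* B)]
      by_contra! hlt
      nlinarith
  calc 9 / 16 * (a * l2norm b ^ 2) ≤ 9 / 16 * l2norm z ^ 2 := by gcongr; exact hY b
    _ = (3 / 4 * l2norm z) ^ 2 := by ring
    _ ≤ (n * l2norm (b ᵥ* B)) ^ 2 :=
      pow_le_pow_left₀ (mul_nonneg (by norm_num) (l2norm_nonneg _)) h3 2
    _ = _ := by ring

/-! ### Concentration of block sizes and Gram matrices -/

section probability

variable {Ω : Type*} [MeasurableSpace Ω]

/-- Hoeffding's inequality for the number of independent events that occur. -/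
lemma measureReal_abs_sum_indicator_ge_le {μ : Measure Ω} [IsProbabilityMeasure μ] {ι : Type*}
    [Fintype ι] {S : ι → Set Ω} (hm : ∀ i, MeasurableSet (S i)) (hS : iIndepSet S μ) {ε : ℝ}
    (hε : 0 ≤ ε) :
    μ.real {ω | ε ≤ |∑ i, (S i).indicator 1 ω - ∑ i, μ.real (S i)|}
      ≤ 2 * Real.exp (-2 * ε ^ 2 / Fintype.card ι) := by
  set X : ι → Ω → ℝ := fun i => (S i).indicator (fun _ => (1 : ℝ)) with hX
  have hXind : iIndepFun X μ := hS.iIndepFun_indicator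
  have hXm : ∀ i, Measurable (X i) := fun i => measurable_const.indicator (hm i)
  have hXint : ∀ i, ∫ ω, X i ω ∂μ = μ.real (S i) := fun i => by
    simp [hX, integral_indicator (hm i)]
  have hsub : ∀ i, HasSubgaussianMGF (fun ω => X i ω - μ.real (S i)) ((‖(1 : ℝ) - 0‖₊ / 2) ^ 2) μ := by
    intro i
    rw [← hXint]
    refine hasSubgaussianMGF_of_mem_Icc (hXm i).aemeasurable (ae_of_all _ fun ω => ?_)
    by_cases h : ω ∈ S i <;> simp [hX, h]
  have hind : iIndepFun (fun i ω => X i ω - μ.real (S i)) μ :=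
    hXind.comp (fun i x => x - μ.real (S i)) fun i => measurable_id.sub_const _
  have hindneg : iIndepFun (fun i ω => -(X i ω - μ.real (S i))) μ :=
    hXind.comp (fun i x => -(x - μ.real (S i))) fun i => (measurable_id.sub_const _).neg
  have h1 := HasSubgaussianMGF.measure_sum_ge_le_of_iIndepFun hind (s := Finset.univ)
    (fun i _ => hsub i) hε
  have h2 := HasSubgaussianMGF.measure_sum_ge_le_of_iIndepFun hindneg (s := Finset.univ)
    (fun i _ => (hsub i).neg) hε
  have hexp : -ε ^ 2 / (2 * ((∑ _i : ι, (‖(1 : ℝ) - 0‖₊ / 2) ^ 2 : NNReal) : ℝ))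
      = -2 * ε ^ 2 / Fintype.card ι := by
    push_cast
    simp only [Finset.sum_const, Finset.card_univ, nsmul_eq_mul, sub_zero, norm_one]
    -- For an empty index type both exponents are 0, by the convention for division by zero.
    rcases eq_or_ne (Fintype.card ι : ℝ) 0 with h | h
    · simp [h]
    · field_simp
  rw [hexp] at h1 h2
  calc μ.real {ω | ε ≤ |∑ i, (S i).indicator 1 ω - ∑ i, μ.real (S i)|}
      ≤ μ.real ({ω | ε ≤ ∑ i, (X i ω - μ.real (S i))} ∪ {ω | ε ≤ ∑ i, -(X i ω - μ.real (S i))}) := by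
        refine measureReal_mono fun ω hω => ?_
        have hω' : ε ≤ |∑ i, (X i ω - μ.real (S i))| := by
          rw [Finset.sum_sub_distrib]; exact hω
        rcases le_abs.1 hω' with h | h
        · exact Or.inl h
        · right
          simpa only [Set.mem_ofPred_eq, Finset.sum_neg_distrib] using h
    _ ≤ _ := (measureReal_union_le _ _).trans (by linarith)

variable {Pr : Measure Ω} {K n : ℕ} {P : Matrix (Fin K) (Fin K) ℝ} {ρ : Fin K → ℝ}
  {τ : Ω → Fin n → Fin K} {A : Ω → Matrix (Fin n) (Fin n) ℝ}

lemma IsDirectedSBM.transpose (h : IsDirectedSBM Pr P ρ τ A) :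
    IsDirectedSBM Pr Pᵀ ρ τ fun ω => (A ω)ᵀ where
  measurable_block := h.measurable_block
  measurable_entry := fun u v => h.measurable_entry v u
  indep_block := h.indep_block
  law_block := h.law_block
  zero_or_one := fun ω u v => h.zero_or_one ω v u
  no_loop := fun ω u => h.no_loop ω u
  cond_indep := fun t ht => (h.cond_indep t ht).precomp Prod.swap_injective
  cond_law := fun t ht u v huv => h.cond_law t ht v u huv.symm

/-- All blocks of a stochastic blockmodel are large, with high probability. -/
lemma IsDirectedSBM.measureReal_exists_block_lt [IsProbabilityMeasure Pr]
    (h : IsDirectedSBM Pr P ρ τ A) (hρ : ∀ i, 0 ≤ ρ i) {γ δ : ℝ} (hδ : 0 ≤ δ)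
    (hγρ : ∀ i, γ + δ ≤ ρ i) :
    Pr.real {ω | ∃ i, ((Finset.univ.filter fun u => τ ω u = i).card : ℝ) < γ * n}
      ≤ K * (2 * Real.exp (-2 * δ ^ 2 * n)) := by
  have hone : ∀ i, Pr.real {ω | ((Finset.univ.filter fun u => τ ω u = i).card : ℝ) < γ * n}
      ≤ 2 * Real.exp (-2 * δ ^ 2 * n) := by
    intro i
    set S : Fin n → Set Ω := fun u => {ω | τ ω u = i} with hS
    have hm : ∀ u, MeasurableSet (S u) := fun u =>
      h.measurable_block u (measurableSet_singleton i)
    have hind : iIndepSet S Pr := by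
      rw [iIndepSet_iff_meas_biInter hm]
      intro s
      exact h.indep_block.measure_inter_preimage_eq_mul s (sets := fun _ => {i})
        fun _ _ => measurableSet_singleton i
    have hreal : ∀ u, Pr.real (S u) = ρ i := fun u => by
      rw [measureReal_def, hS, h.law_block, ENNReal.toReal_ofReal (hρ i)]
    have hH := measureReal_abs_sum_indicator_ge_le hm hind (ε := δ * n) (by positivity)
    have he : -2 * (δ * n) ^ 2 / (Fintype.card (Fin n) : ℝ) = -2 * δ ^ 2 * n := by
      rw [Fintype.card_fin]
      rcases eq_or_ne (n : ℝ) 0 with h | h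
      · simp [h]
      · field_simp
    rw [he] at hH
    refine (measureReal_mono fun ω hω => ?_).trans hH
    have hcount : ∑ u, (S u).indicator (1 : Ω → ℝ) ω
        = (Finset.univ.filter fun u => τ ω u = i).card := by
      simp [Set.indicator_apply, hS]
    simp only [Set.mem_ofPred_eq] at hω ⊢
    rw [hcount]
    simp only [hreal, Finset.sum_const, Finset.card_univ, Fintype.card_fin, nsmul_eq_mul]
    refine le_trans ?_ (neg_le_abs _)
    have := mul_le_mul_of_nonneg_right (hγρ i) (Nat.cast_nonneg (α := ℝ) n)
    linarith
  calc _ ≤ Pr.real (⋃ i, {ω | ((Finset.univ.filter fun u => τ ω u = i).card : ℝ) < γ * n}) :=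
        measureReal_mono fun ω hω => Set.mem_iUnion.2 hω
    _ ≤ ∑ i, Pr.real {ω | ((Finset.univ.filter fun u => τ ω u = i).card : ℝ) < γ * n} :=
        measureReal_iUnion_fintype_le _
    _ ≤ ∑ _i : Fin K, 2 * Real.exp (-2 * δ ^ 2 * n) := Finset.sum_le_sum fun i _ => hone i
    _ = _ := by simp

/-- The conditional mean of the adjacency matrix, given the block memberships `t`. -/
def meanAdj (P : Matrix (Fin K) (Fin K) ℝ) (t : Fin n → Fin K) (u v : Fin n) : ℝ :=
  if u = v then 0 else P (t u) (t v)

/-- Because `i ≠ j`, the products `A i k * A j k` for different `k` use disjoint pairs of entries.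
They are indicators of independent events, so Hoeffding applies. -/
lemma IsDirectedSBM.cond_measureReal_gram_ge [IsProbabilityMeasure Pr]
    (h : IsDirectedSBM Pr P ρ τ A) (hP : ∀ i j, 0 ≤ P i j) {t : Fin n → Fin K}
    (ht : Pr {ω | τ ω = t} ≠ 0) {i j : Fin n} (hij : i ≠ j) {ε : ℝ} (hε : 0 ≤ ε) :
    (cond Pr {ω | τ ω = t}).real
      {ω | ε ≤ |∑ k, A ω i k * A ω j k - ∑ k, meanAdj P t i k * meanAdj P t j k|}
      ≤ 2 * Real.exp (-2 * ε ^ 2 / n) := by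
  set μ := cond Pr {ω | τ ω = t} with hμ
  have : IsProbabilityMeasure μ := cond_isProbabilityMeasure ht
  set T : Fin n × Fin n → Set Ω := fun e => {ω | A ω e.1 e.2 = 1} with hT
  have hTm : ∀ e, MeasurableSet (T e) := fun e =>
    h.measurable_entry e.1 e.2 (measurableSet_singleton 1)
  have hTind : ∀ s : Finset (Fin n × Fin n), μ (⋂ e ∈ s, T e) = ∏ e ∈ s, μ (T e) := fun s =>
    (h.cond_indep t ht).measure_inter_preimage_eq_mul s (sets := fun _ => {1})
      fun _ _ => measurableSet_singleton 1
  have hTreal : ∀ u v, μ.real (T (u, v)) = meanAdj P t u v := by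
    intro u v
    by_cases huv : u = v
    · subst huv
      have : T (u, u) = ∅ := by ext ω; simp [hT, h.no_loop]
      simp [this, meanAdj]
    · simp only [meanAdj, huv, if_false]
      rw [measureReal_def, hμ, h.cond_law t ht u v huv, ENNReal.toReal_ofReal (hP _ _)]
  set S : Fin n → Set Ω := fun k => T (i, k) ∩ T (j, k) with hS
  have hSm : ∀ k, MeasurableSet (S k) := fun k => (hTm _).inter (hTm _)
  have hSmeas : ∀ s : Finset (Fin n), μ (⋂ k ∈ s, S k) = ∏ k ∈ s, μ (T (i, k)) * μ (T (j, k)) := by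
    intro s
    have := hTind (({i, j} : Finset (Fin n)) ×ˢ s)
    rw [Finset.prod_product_right] at this
    simp only [Finset.prod_pair hij] at this
    rw [← this]
    congr 1
    ext ω
    simp only [Set.mem_iInter, Finset.mem_product, Finset.mem_insert, Finset.mem_singleton, hS,
      Set.mem_inter_iff]
    constructor
    · rintro h1 ⟨u, k⟩ ⟨rfl | rfl, hk⟩
      exacts [(h1 k hk).1, (h1 k hk).2]
    · exact fun h1 k hk => ⟨h1 (i, k) ⟨Or.inl rfl, hk⟩, h1 (j, k) ⟨Or.inr rfl, hk⟩⟩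
  have hSone : ∀ k, μ (S k) = μ (T (i, k)) * μ (T (j, k)) := fun k => by
    simpa using hSmeas {k}
  have hSind : iIndepSet S μ := by
    rw [iIndepSet_iff_meas_biInter hSm]
    intro s
    rw [hSmeas]
    exact Finset.prod_congr rfl fun k _ => (hSone k).symm
  have hSreal : ∀ k, μ.real (S k) = meanAdj P t i k * meanAdj P t j k := fun k => by
    rw [← hTreal, ← hTreal, measureReal_def, hSone, ENNReal.toReal_mul]; rfl
  have hH := measureReal_abs_sum_indicator_ge_le hSm hSind hε
  have hind : ∀ ω k, (S k).indicator (1 : Ω → ℝ) ω = A ω i k * A ω j k := by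
    intro ω k
    rcases h.zero_or_one ω i k with h1 | h1 <;> rcases h.zero_or_one ω j k with h2 | h2 <;>
      simp [hS, hT, h1, h2]
  simpa only [hind, hSreal, Fintype.card_fin] using hH

/-- The conditional bound does not depend on `t`, so averaging over the block memberships preserves
it; a union bound over pairs follows. -/
lemma IsDirectedSBM.measureReal_exists_gram_ge [IsProbabilityMeasure Pr]
    (h : IsDirectedSBM Pr P ρ τ A) (hP : ∀ i j, 0 ≤ P i j) {ε : ℝ} (hε : 0 ≤ ε) :
    Pr.real {ω | ∃ i j, i ≠ j ∧
      ε ≤ |∑ k, A ω i k * A ω j k - ∑ k, meanAdj P (τ ω) i k * meanAdj P (τ ω) j k|}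
      ≤ n ^ 2 * (2 * Real.exp (-2 * ε ^ 2 / n)) := by
  set b := 2 * Real.exp (-2 * ε ^ 2 / n) with hb
  have hb0 : 0 ≤ b := by positivity
  have hτ : Measurable τ := measurable_pi_iff.2 h.measurable_block
  have htm : ∀ t, MeasurableSet {ω | τ ω = t} := fun t => hτ (measurableSet_singleton t)
  have hone : ∀ i j, Pr.real {ω | i ≠ j ∧
      ε ≤ |∑ k, A ω i k * A ω j k - ∑ k, meanAdj P (τ ω) i k * meanAdj P (τ ω) j k|} ≤ b := by
    intro i j
    by_cases hij : i = j
    · simp [hij, hb0]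
    set B := {ω | i ≠ j ∧
      ε ≤ |∑ k, A ω i k * A ω j k - ∑ k, meanAdj P (τ ω) i k * meanAdj P (τ ω) j k|} with hB
    have hpiece : ∀ t, Pr.real ({ω | τ ω = t} ∩ B) ≤ Pr.real {ω | τ ω = t} * b := by
      intro t
      by_cases ht : Pr {ω | τ ω = t} = 0
      · have : Pr ({ω | τ ω = t} ∩ B) = 0 := measure_mono_null Set.inter_subset_left ht
        rw [measureReal_def, this]
        positivity
      · rw [measureReal_def, ← cond_mul_eq_inter (htm t), ENNReal.toReal_mul, mul_comm,
          ← measureReal_def, ← measureReal_def]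
        refine mul_le_mul_of_nonneg_left ?_ measureReal_nonneg
        -- The conditional measure lives on `τ ω = t`, which allows `τ ω` to be replaced by `t` in
        -- the mean.
        rw [measureReal_def, ← cond_inter_self (htm t), ← measureReal_def]
        refine le_trans (measureReal_mono ?_) (h.cond_measureReal_gram_ge hP ht hij hε)
        rintro ω ⟨hω, -, h2⟩
        rw [Set.mem_ofPred_eq] at hω
        rw [hω] at h2
        exact h2
    calc Pr.real B = Pr.real (⋃ t, ({ω | τ ω = t} ∩ B)) := by
          congr 1; ext ω; simp
      _ ≤ ∑ t, Pr.real ({ω | τ ω = t} ∩ B) := measureReal_iUnion_fintype_le _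
      _ ≤ ∑ t, Pr.real {ω | τ ω = t} * b := Finset.sum_le_sum fun t _ => hpiece t
      _ = b := by
        rw [← Finset.sum_mul]
        have : ∑ t, Pr.real {ω | τ ω = t} = 1 := by
          rw [← probReal_univ (μ := Pr)]
          have := sum_measureReal_preimage_singleton (μ := Pr) (f := τ) Finset.univ
            (fun t _ => htm t)
          rw [Finset.coe_univ, Set.preimage_univ] at this
          exact this
        rw [this, one_mul]
  calc _ ≤ Pr.real (⋃ i, ⋃ j, {ω | i ≠ j ∧
      ε ≤ |∑ k, A ω i k * A ω j k - ∑ k, meanAdj P (τ ω) i k * meanAdj P (τ ω) j k|}) :=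
        measureReal_mono fun ω hω => Set.mem_iUnion₂.2 hω
    _ ≤ ∑ i : Fin n, ∑ j : Fin n, b :=
        (measureReal_iUnion_fintype_le _).trans (Finset.sum_le_sum fun i _ =>
          (measureReal_iUnion_fintype_le _).trans (Finset.sum_le_sum fun j _ => hone i j))
    _ = _ := by simp; ring

end probability

/-! ### Deterministic bounds: Gram error, clustering, misassignments -/

section deterministic

variable {K n d : ℕ}

/-- A bound on the Gram matrix of a loopless graph from bounds on its off-diagonal deviations. -/
lemma frobSq_gram_sub_le {P : Matrix (Fin K) (Fin K) ℝ} (hP : ∀ i j, P i j ∈ Set.Icc (0 : ℝ) 1)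
    (t : Fin n → Fin K) {A : Matrix (Fin n) (Fin n) ℝ} (hA : ∀ u v, A u v = 0 ∨ A u v = 1) {ε : ℝ}
    (h : ∀ i j, i ≠ j →
      |∑ k, A i k * A j k - ∑ k, meanAdj P t i k * meanAdj P t j k| ≤ ε) :
    frobSq (A * Aᵀ - P.submatrix t t * (P.submatrix t t)ᵀ) ≤ n ^ 2 * (ε + 2) ^ 2 + n ^ 3 := by
  have hPP : ∀ i j k l, P i j * P k l ∈ Set.Icc (0 : ℝ) 1 := fun i j k l =>
    ⟨mul_nonneg (hP i j).1 (hP k l).1, mul_le_one₀ (hP i j).2 (hP k l).1 (hP k l).2⟩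
  -- Removing loops changes only the terms `k = i` and `k = j`, each by at most 1.
  have hmean : ∀ i j, |∑ k, meanAdj P t i k * meanAdj P t j k
      - ∑ k, P (t i) (t k) * P (t j) (t k)| ≤ 2 := by
    intro i j
    rw [← Finset.sum_sub_distrib]
    calc _ ≤ ∑ k, |meanAdj P t i k * meanAdj P t j k - P (t i) (t k) * P (t j) (t k)| :=
          Finset.abs_sum_le_sum_abs _ _
      _ ≤ ∑ k, ((if i = k then 1 else 0) + if j = k then 1 else 0) := by
          refine Finset.sum_le_sum fun k _ => ?_
          have h1 := hPP (t i) (t k) (t j) (t k)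
          by_cases hik : i = k <;> by_cases hjk : j = k <;> simp only [meanAdj, hik, hjk, if_true,
            if_false, zero_mul, mul_zero, zero_sub, abs_neg, sub_self, abs_zero] <;>
            (try simp only [hik, hjk] at h1) <;> (try rw [abs_of_nonneg h1.1]) <;> linarith [h1.2]
      _ = 2 := by rw [Finset.sum_add_distrib]; simp; norm_num
  have hentry : ∀ i j, ((A * Aᵀ - P.submatrix t t * (P.submatrix t t)ᵀ) i j) ^ 2
      ≤ (ε + 2) ^ 2 + if i = j then (n : ℝ) ^ 2 else 0 := by
    intro i j
    have he : (A * Aᵀ - P.submatrix t t * (P.submatrix t t)ᵀ) i j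
        = ∑ k, A i k * A j k - ∑ k, P (t i) (t k) * P (t j) (t k) := by
      simp [mul_apply]
    rw [he]
    -- Diagonal entries do not concentrate around those of `M Mᵀ`, since `A i k ^ 2 = A i k`. The
    -- trivial bound `n` suffices: together they contribute `n ^ 3`.
    by_cases hij : i = j
    · have h1 : 0 ≤ ∑ k, A i k * A j k ∧ ∑ k, A i k * A j k ≤ n := by
        constructor
        · refine Finset.sum_nonneg fun k _ => ?_
          rcases hA i k with h1 | h1 <;> rcases hA j k with h2 | h2 <;> simp [h1, h2]
        · calc _ ≤ ∑ _k : Fin n, (1 : ℝ) := Finset.sum_le_sum fun k _ => by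
                rcases hA i k with h1 | h1 <;> rcases hA j k with h2 | h2 <;> simp [h1, h2]
            _ = n := by simp
      have h2 : 0 ≤ ∑ k, P (t i) (t k) * P (t j) (t k)
          ∧ ∑ k, P (t i) (t k) * P (t j) (t k) ≤ n := by
        constructor
        · exact Finset.sum_nonneg fun k _ => (hPP _ _ _ _).1
        · calc _ ≤ ∑ _k : Fin n, (1 : ℝ) := Finset.sum_le_sum fun k _ => (hPP _ _ _ _).2
            _ = n := by simp
      rw [if_pos hij]
      have h3 : (∑ k, A i k * A j k - ∑ k, P (t i) (t k) * P (t j) (t k)) ^ 2 ≤ (n : ℝ) ^ 2 :=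
        sq_le_sq' (by linarith [h1.1, h2.2]) (by linarith [h1.2, h2.1])
      linarith [sq_nonneg (ε + 2)]
    · rw [if_neg hij, add_zero]
      have h3 := (abs_sub_le _ _ _).trans (add_le_add (h i j hij) (hmean i j))
      rw [abs_le] at h3
      exact sq_le_sq' h3.1 h3.2
  calc _ ≤ ∑ i : Fin n, ∑ j : Fin n, ((ε + 2) ^ 2 + if i = j then (n : ℝ) ^ 2 else 0) :=
        Finset.sum_le_sum fun i _ => Finset.sum_le_sum fun j _ => hentry i j
    _ = _ := by simp [Finset.sum_add_distrib]; ring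

/-- Minimizers of the squared error recover well-separated clusters up to few errors. -/
lemma IsMSEClustering.numMisassigned_le {m : Type*} [Fintype m] {Z : Matrix (Fin n) m ℝ}
    {τ τ' : Fin n → Fin K} (h : IsMSEClustering Z τ') (w : Matrix (Fin K) m ℝ) {s b : ℝ}
    (hs : 0 < s) (hsep : ∀ i j, i ≠ j → s ≤ l2dist (w i) (w j))
    (hb : 16 * squaredError Z w τ ≤ b * s ^ 2)
    (hblock : ∀ i, b < (Finset.univ.filter fun u => τ u = i).card) :
    (numMisassigned τ τ' : ℝ) ≤ b := by
  obtain ⟨ψ, hψ⟩ := h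
  -- Nodes outside `bad` with the same estimated label have the same true label, as their centers
  -- are less than `s` apart.
  set bad := Finset.univ.filter fun u => s / 2 ≤ l2dist (ψ (τ' u)) (w (τ u)) with hbad
  have hsum : ∑ u, l2dist (ψ (τ' u)) (w (τ u)) ^ 2 ≤ 4 * squaredError Z w τ := by
    have h1 : ∀ u, l2dist (ψ (τ' u)) (w (τ u)) ^ 2
        ≤ 2 * l2dist (Z u) (ψ (τ' u)) ^ 2 + 2 * l2dist (Z u) (w (τ u)) ^ 2 := fun u => by
      have h2 : l2dist (ψ (τ' u)) (w (τ u)) ≤ l2dist (Z u) (ψ (τ' u)) + l2dist (Z u) (w (τ u)) := by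
        simp only [l2dist_eq]
        rw [l2norm_sub_comm (Z u) (ψ (τ' u))]
        exact l2norm_sub_le _ _ _
      have h3 := pow_le_pow_left₀ (norm_nonneg _) h2 2
      refine h3.trans ?_
      nlinarith [sq_nonneg (l2dist (Z u) (ψ (τ' u)) - l2dist (Z u) (w (τ u)))]
    calc _ ≤ ∑ u, (2 * l2dist (Z u) (ψ (τ' u)) ^ 2 + 2 * l2dist (Z u) (w (τ u)) ^ 2) :=
          Finset.sum_le_sum fun u _ => h1 u
      _ = 2 * squaredError Z ψ τ' + 2 * squaredError Z w τ := by
          simp only [Finset.sum_add_distrib, squaredError, Finset.mul_sum]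
      _ ≤ _ := by linarith [hψ w τ]
  have hbadcard : (bad.card : ℝ) ≤ b := by
    have h1 : (bad.card : ℝ) * (s / 2) ^ 2 ≤ 4 * squaredError Z w τ := by
      refine le_trans ?_ hsum
      calc (bad.card : ℝ) * (s / 2) ^ 2 = ∑ u ∈ bad, (s / 2) ^ 2 := by simp
        _ ≤ ∑ u ∈ bad, l2dist (ψ (τ' u)) (w (τ u)) ^ 2 :=
          Finset.sum_le_sum fun u hu =>
            pow_le_pow_left₀ (by positivity) (Finset.mem_filter.1 hu).2 2
        _ ≤ _ := Finset.sum_le_sum_of_subset_of_nonneg (Finset.subset_univ _)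
          fun _ _ _ => sq_nonneg _
    have : 0 < s ^ 2 := by positivity
    nlinarith
  -- Every block has more than `b` nodes, hence one outside `bad`. Its estimated label defines an
  -- injection of `Fin K` into itself, that is, a permutation.
  have hgood : ∀ i, ∃ u, τ u = i ∧ l2dist (ψ (τ' u)) (w (τ u)) < s / 2 := by
    intro i
    by_contra! hc
    have : (Finset.univ.filter fun u => τ u = i) ⊆ bad := fun u hu => by
      simp only [Finset.mem_filter, Finset.mem_univ, true_and, hbad] at hu ⊢
      exact hc u hu
    have h2 : ((Finset.univ.filter fun u => τ u = i).card : ℝ) ≤ bad.card :=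
      Nat.cast_le.2 (Finset.card_le_card this)
    linarith [hblock i]
  have hkey : ∀ u v, l2dist (ψ (τ' u)) (w (τ u)) < s / 2 → l2dist (ψ (τ' v)) (w (τ v)) < s / 2 →
      τ' u = τ' v → τ u = τ v := by
    intro u v hu hv huv
    by_contra hne
    have h1 := hsep _ _ hne
    rw [huv] at hu
    simp only [l2dist_eq] at h1 hu hv
    rw [l2norm_sub_comm] at hu
    linarith [l2norm_sub_le (w (τ u)) (ψ (τ' v)) (w (τ v))]
  choose g hgτ hg using hgood
  have hinj : Function.Injective fun i => τ' (g i) := fun i j hij => by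
    rw [← hgτ i, ← hgτ j]
    exact hkey _ _ (hg i) (hg j) hij
  let e : Equiv.Perm (Fin K) := Equiv.ofBijective _ (Finite.injective_iff_bijective.1 hinj)
  have h1 : numMisassigned τ τ' ≤ (Finset.univ.filter fun u => τ u ≠ e.symm (τ' u)).card :=
    Finset.inf'_le _ (Finset.mem_univ e.symm)
  have h2 : (Finset.univ.filter fun u => τ u ≠ e.symm (τ' u)) ⊆ bad := by
    intro u hu
    simp only [Finset.mem_filter, Finset.mem_univ, true_and, hbad] at hu ⊢
    by_contra! hc
    apply hu
    have h3 : τ' (g (e.symm (τ' u))) = τ' u := e.apply_symm_apply (τ' u)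
    rw [hkey u _ hc (hg _) h3.symm, hgτ]
  exact (Nat.cast_le.2 (h1.trans (Finset.card_le_card h2))).trans hbadcard

/-- The symmetric matrix `Nᵀ * N - α • 1` has nonnegative eigenvalues, so its quadratic form is
nonnegative. -/
lemma le_l2norm_mulVec_of_eigenvalue {k l : Type*} [Fintype k] [Fintype l] [DecidableEq l]
    (N : Matrix k l ℝ) {α : ℝ}
    (h : ∀ x : ℝ, Module.End.HasEigenvalue (Matrix.toLin' (Nᵀ * N)) x → α < x) (y : l → ℝ) :
    α * l2norm y ^ 2 ≤ l2norm (N *ᵥ y) ^ 2 := by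
  have hH : (Nᵀ * N - α • (1 : Matrix l l ℝ)).IsHermitian := by
    ext i j
    simp [mul_apply, one_apply, mul_comm, eq_comm]
  have hpsd : (Nᵀ * N - α • (1 : Matrix l l ℝ)).PosSemidef := by
    rw [hH.posSemidef_iff_eigenvalues_nonneg]
    intro i
    have h1 := hH.mulVec_eigenvectorBasis i
    have h2 : Module.End.HasEigenvalue (Matrix.toLin' (Nᵀ * N)) (hH.eigenvalues i + α) := by
      refine Module.End.hasEigenvalue_of_hasEigenvector (x := ⇑(hH.eigenvectorBasis i)) ⟨?_, ?_⟩
      · rw [Module.End.mem_eigenspace_iff, toLin'_apply]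
        rw [sub_mulVec, smul_mulVec, one_mulVec, sub_eq_iff_eq_add] at h1
        rw [h1, add_smul]
      · intro h0
        exact hH.eigenvectorBasis.orthonormal.ne_zero i (by ext j; exact congrFun h0 j)
    have := h _ h2
    simp only [Pi.zero_apply]
    linarith
  have h3 := hpsd.dotProduct_mulVec_nonneg y
  rw [sub_mulVec, smul_mulVec, one_mulVec, dotProduct_sub, dotProduct_smul, ← mulVec_mulVec,
    dotProduct_mulVec, star_trivial, vecMul_transpose, ← l2norm_sq_eq_dotProduct,
    ← l2norm_sq_eq_dotProduct, smul_eq_mul] at h3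
  linarith

/-- Each row of `N` is repeated at least `γ * n` times. -/
lemma le_l2norm_submatrix_mulVec {N : Matrix (Fin K) (Fin d) ℝ} {α γ : ℝ} (hγ : 0 ≤ γ)
    (hN : ∀ y, α * l2norm y ^ 2 ≤ l2norm (N *ᵥ y) ^ 2) {t : Fin n → Fin K}
    (ht : ∀ i, γ * n ≤ (Finset.univ.filter fun u => t u = i).card) (y : Fin d → ℝ) :
    α * γ * n * l2norm y ^ 2 ≤ l2norm (N.submatrix t id *ᵥ y) ^ 2 := by
  have h1 : l2norm (N.submatrix t id *ᵥ y) ^ 2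
      = ∑ i, ((Finset.univ.filter fun u => t u = i).card : ℝ) * (N *ᵥ y) i ^ 2 := by
    rw [l2norm_sq, ← Finset.sum_fiberwise Finset.univ t]
    refine Finset.sum_congr rfl fun i _ => ?_
    rw [Finset.sum_congr rfl (g := fun _ => (N *ᵥ y) i ^ 2), Finset.sum_const, nsmul_eq_mul]
    intro u hu
    rw [← (Finset.mem_filter.1 hu).2]
    rfl
  rw [h1]
  calc α * γ * n * l2norm y ^ 2 = γ * n * (α * l2norm y ^ 2) := by ring
    _ ≤ γ * n * l2norm (N *ᵥ y) ^ 2 := by gcongr; exact hN y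
    _ = ∑ i, γ * n * (N *ᵥ y) i ^ 2 := by rw [l2norm_sq, Finset.mul_sum]
    _ ≤ _ := Finset.sum_le_sum fun i _ => by gcongr; exact ht i

/-- The number of errors of spectral clustering, given a bound on the deviation of the Gram matrices
of the adjacency matrix. -/
lemma numMisassigned_le_of_gram_near {P : Matrix (Fin K) (Fin K) ℝ}
    (hP : ∀ i j, P i j ∈ Set.Icc (0 : ℝ) 1) {ν μ : Matrix (Fin K) (Fin d) ℝ} (hνμ : ν * μᵀ = P)
    {α β γ : ℝ} (hα : 0 < α) (hβ : 0 < β) (hγ : 0 < γ)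
    (hν : ∀ y, α * l2norm y ^ 2 ≤ l2norm (ν *ᵥ y) ^ 2)
    (hμ : ∀ y, α * l2norm y ^ 2 ≤ l2norm (μ *ᵥ y) ^ 2)
    (hsep : ∀ i j, i ≠ j → β < l2dist (ν i) (ν j) ∨ β < l2dist (μ i) (μ j))
    {t : Fin n → Fin K} (hn : 0 < n)
    (ht : ∀ i, γ * n ≤ (Finset.univ.filter fun u => t u = i).card)
    {A : Matrix (Fin n) (Fin n) ℝ} {e b : ℝ} (he0 : 0 ≤ e)
    (hE : frobSq (A * Aᵀ - P.submatrix t t * (P.submatrix t t)ᵀ) ≤ e ^ 2)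
    (hE' : frobSq (Aᵀ * Aᵀᵀ - Pᵀ.submatrix t t * (Pᵀ.submatrix t t)ᵀ) ≤ e ^ 2)
    (he : e ≤ 3 / 16 * (α * γ * n) ^ 2) (hb : b < γ * n)
    (hbe : 16 * (2 * (e / (3 / 4 * (α * γ * n) ^ 2)) ^ 2) ≤ b * (9 / 16 * (α * γ * β ^ 2 / n)))
    {U V : Matrix (Fin n) (Fin d) ℝ} {τ' : Fin n → Fin K} (hUV : IsUnscaledASE A U V)
    (hτ' : IsMSEClustering (fromCols U V) τ') : (numMisassigned t τ' : ℝ) ≤ b := by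
  obtain ⟨hdn, U', σ, V', hsvd, rfl, rfl⟩ := hUV
  have hn' : (0 : ℝ) < n := Nat.cast_pos.2 hn
  have ha : 0 < α * γ * n := by positivity
  have hX := le_l2norm_submatrix_mulVec hγ.le hν ht
  have hY := le_l2norm_submatrix_mulVec hγ.le hμ ht
  have hXY : ν.submatrix t id * (μ.submatrix t id)ᵀ = P.submatrix t t := by
    rw [← hνμ]; ext u v; simp [mul_apply]
  have hYX : μ.submatrix t id * (ν.submatrix t id)ᵀ = Pᵀ.submatrix t t := by
    rw [← hνμ]; ext u v; simp [mul_apply]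
  obtain ⟨B, hB1, hB2⟩ := hsvd.exists_approx hdn (ν.submatrix t id) (μ.submatrix t id) ha hX hY
    (by rw [hXY]; exact fun u v => hP _ _) he0 (by rw [hXY]; exact hE) he
  obtain ⟨C, hC1, hC2⟩ := hsvd.transpose.exists_approx hdn (μ.submatrix t id) (ν.submatrix t id)
    ha hY hX (by rw [hYX]; exact fun u v => hP _ _) he0 (by rw [hYX]; exact hE') he
  -- Reference centers. Squared distances add over the two halves, so separation in either `ν` or
  -- `μ` is enough.
  set w : Matrix (Fin K) (Fin d ⊕ Fin d) ℝ := fromCols (ν * B) (μ * C) with hw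
  have hs2 : 0 < 9 / 16 * (α * γ * β ^ 2 / n) := by positivity
  have hlow : ∀ (N : Matrix (Fin K) (Fin d) ℝ) (D : Matrix (Fin d) (Fin d) ℝ),
      (∀ b, 9 / 16 * (α * γ * n * l2norm b ^ 2) ≤ (n : ℝ) ^ 2 * l2norm (b ᵥ* D) ^ 2) →
      ∀ i j : Fin K, β < l2dist (N i) (N j) →
      9 / 16 * (α * γ * β ^ 2 / n) ≤ l2norm ((N * D) i - (N * D) j) ^ 2 := by
    intro N D hD i j hij
    have h1 := hD (N i - N j)
    have h2 : (N i - N j) ᵥ* D = (N * D) i - (N * D) j := by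
      rw [sub_vecMul]; rfl
    rw [h2] at h1
    rw [l2dist_eq] at hij
    have h3 : β ^ 2 ≤ l2norm (N i - N j) ^ 2 := pow_le_pow_left₀ hβ.le hij.le 2
    have h4 : 9 / 16 * (α * γ * n * β ^ 2) ≤ n ^ 2 * l2norm ((N * D) i - (N * D) j) ^ 2 := by
      refine le_trans ?_ h1
      gcongr
    have h5 : 9 / 16 * (α * γ * β ^ 2 / n) = 9 / 16 * (α * γ * n * β ^ 2) / n ^ 2 := by
      field_simp
    rw [h5, div_le_iff₀ (by positivity)]
    linarith
  have hwdist : ∀ i j, l2norm (w i - w j) ^ 2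
      = l2norm ((ν * B) i - (ν * B) j) ^ 2 + l2norm ((μ * C) i - (μ * C) j) ^ 2 := fun i j => by
    simp [l2norm_sq, hw, fromCols]
  refine hτ'.numMisassigned_le w (s := √(9 / 16 * (α * γ * β ^ 2 / n))) (Real.sqrt_pos.2 hs2)
    (fun i j hij => ?_) ?_ fun i => hb.trans_le (ht i)
  · rw [l2dist_eq]
    apply Real.sqrt_le_left (l2norm_nonneg _) |>.2
    rw [hwdist]
    rcases hsep i j hij with h | h
    · exact (hlow ν B hB2 i j h).trans (le_add_of_nonneg_right (sq_nonneg _))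
    · exact (hlow μ C hC2 i j h).trans (le_add_of_nonneg_left (sq_nonneg _))
  · rw [Real.sq_sqrt hs2.le]
    refine le_trans ?_ hbe
    gcongr
    have : squaredError (fromCols (U'.submatrix id (Fin.castLE hdn))
        (V'.submatrix id (Fin.castLE hdn))) w t
        = frobSq (U'.submatrix id (Fin.castLE hdn) - ν.submatrix t id * B)
          + frobSq (V'.submatrix id (Fin.castLE hdn) - μ.submatrix t id * C) := by
      simp [squaredError, l2dist_eq, l2norm_sq, frobSq, hw, fromCols, Finset.sum_add_distrib,
        mul_apply]
    rw [this]
    linarith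

end deterministic

/-! ### Almost sure bounds and conclusion -/

/-- The **Borel–Cantelli lemma**, with summable bounds on the probabilities. -/
lemma ae_eventually_notMem_of_measureReal_le {Ω : Type*} [MeasurableSpace Ω] {Pr : Measure Ω}
    [IsFiniteMeasure Pr] {s : ℕ → Set Ω} {f : ℕ → ℝ} (hf : Summable f)
    (h : ∀ n, Pr.real (s n) ≤ f n) : ∀ᵐ ω ∂Pr, ∀ᶠ n in atTop, ω ∉ s n := by
  refine ae_eventually_notMem (ne_top_of_le_ne_top hf.tsum_ofReal_ne_top ?_)
  refine ENNReal.tsum_le_tsum fun n => ?_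
  rw [← ofReal_measureReal]
  exact ENNReal.ofReal_le_ofReal (h n)

section SBM

variable {Ω : Type*} [MeasurableSpace Ω] {Pr : Measure Ω} [IsProbabilityMeasure Pr] {K : ℕ}
  {P : Matrix (Fin K) (Fin K) ℝ} {ρ : Fin K → ℝ} {τ : (n : ℕ) → Ω → Fin n → Fin K}
  {A : (n : ℕ) → Ω → Matrix (Fin n) (Fin n) ℝ}

lemma ae_eventually_le_card_block (hSBM : ∀ n, IsDirectedSBM Pr P ρ (τ n) (A n))
    (hρ : ∀ i, 0 ≤ ρ i) {γ : ℝ} (hγρ : ∀ i, γ < ρ i) :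
    ∀ᵐ ω ∂Pr, ∀ᶠ n : ℕ in atTop,
      ∀ i, γ * n ≤ (Finset.univ.filter fun u => τ n ω u = i).card := by
  obtain ⟨δ, hδ, hδρ⟩ : ∃ δ > 0, ∀ i, γ + δ ≤ ρ i := by
    rcases isEmpty_or_nonempty (Fin K) with hK | hK
    · exact ⟨1, one_pos, fun i => hK.elim i⟩
    · obtain ⟨i₀, hi₀⟩ := Finite.exists_min ρ
      exact ⟨ρ i₀ - γ, sub_pos.2 (hγρ i₀), fun i => by linarith [hi₀ i]⟩
  have hsum : Summable fun n : ℕ => K * (2 * Real.exp (-2 * δ ^ 2 * n)) := by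
    have : Summable fun n : ℕ => Real.exp (n * (-2 * δ ^ 2)) :=
      Real.summable_exp_nat_mul_iff.2 (by nlinarith)
    simpa only [mul_comm] using (this.mul_left 2).mul_left (K : ℝ)
  filter_upwards [ae_eventually_notMem_of_measureReal_le hsum fun n =>
    (hSBM n).measureReal_exists_block_lt hρ hδ.le hδρ] with ω hω
  filter_upwards [hω] with n hn i
  by_contra! hc
  exact hn ⟨i, hc⟩

lemma ae_eventually_frobSq_gram_sub_le (hSBM : ∀ n, IsDirectedSBM Pr P ρ (τ n) (A n))
    (hP : ∀ i j, P i j ∈ Set.Icc (0 : ℝ) 1) :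
    ∀ᵐ ω ∂Pr, ∀ᶠ n : ℕ in atTop,
      frobSq (A n ω * (A n ω)ᵀ
        - P.submatrix (τ n ω) (τ n ω) * (P.submatrix (τ n ω) (τ n ω))ᵀ)
        ≤ 3 * n ^ 3 * Real.log n := by
  have hsum : Summable fun n : ℕ => 2 * (1 / (n : ℝ) ^ 2) :=
    (Real.summable_one_div_nat_pow.2 one_lt_two).mul_left 2
  -- The threshold `√(2 n log n)` gives a tail of `n⁻⁴`, which remains summable after the union over
  -- `n²` pairs.
  have hbound : ∀ n : ℕ, (n : ℝ) ^ 2 * (2 * Real.exp (-2 * √(2 * n * Real.log n) ^ 2 / n))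
      ≤ 2 * (1 / (n : ℝ) ^ 2) := by
    intro n
    rcases Nat.eq_zero_or_pos n with rfl | hn
    · simp
    have hn' : (0 : ℝ) < n := Nat.cast_pos.2 hn
    have hlog : 0 ≤ Real.log n := Real.log_natCast_nonneg n
    rw [Real.sq_sqrt (by positivity)]
    have : -2 * (2 * n * Real.log n) / n = -((4 : ℕ) * Real.log n) := by
      field_simp; norm_num; ring
    rw [this, Real.exp_neg, Real.exp_nat_mul, Real.exp_log hn']
    apply le_of_eq
    field_simp
  have hlog4 : ∀ᶠ n : ℕ in atTop, 4 ≤ Real.log n :=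
    (Real.tendsto_log_atTop.comp tendsto_natCast_atTop_atTop).eventually_ge_atTop 4
  filter_upwards [ae_eventually_notMem_of_measureReal_le hsum fun n =>
    ((hSBM n).measureReal_exists_gram_ge (fun i j => (hP i j).1) (Real.sqrt_nonneg _)).trans
      (hbound n)] with ω hω
  filter_upwards [hω, hlog4, eventually_ge_atTop 20] with n hn h4 h20
  have h20' : (20 : ℝ) ≤ n := by exact_mod_cast h20
  refine (frobSq_gram_sub_le hP (τ n ω) ((hSBM n).zero_or_one ω)
    (ε := √(2 * n * Real.log n)) fun i j hij => ?_).trans ?_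
  · by_contra! hc
    exact hn ⟨i, j, hij, hc.le⟩
  · set x := √(2 * n * Real.log n) with hx
    have hx2 : x ^ 2 = 2 * n * Real.log n := Real.sq_sqrt (by positivity)
    -- The difference of the two sides is `(x - 8) ^ 2 / 4`. The leading coefficient `5 / 2` leaves
    -- `1 / 2` to absorb `20 + n`, for a total of 3.
    have h1 : (x + 2) ^ 2 ≤ 5 / 4 * (2 * n * Real.log n) + 20 := by
      rw [← hx2]; nlinarith [sq_nonneg (x - 8)]
    have h2 : 20 + (n : ℝ) ≤ 1 / 2 * (n * Real.log n) := by nlinarith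
    calc (n : ℝ) ^ 2 * (x + 2) ^ 2 + n ^ 3 = n ^ 2 * ((x + 2) ^ 2 + n) := by ring
      _ ≤ n ^ 2 * (3 * n * Real.log n) := by gcongr; linarith
      _ = _ := by ring

end SBM

theorem theorem1 {Ω : Type*} [MeasurableSpace Ω] (Pr : Measure Ω) [IsProbabilityMeasure Pr]
    {K d : ℕ} (P : Matrix (Fin K) (Fin K) ℝ) (ρ : Fin K → ℝ)
    (hP : ∀ i j, P i j ∈ Set.Icc (0 : ℝ) 1) (hρ : ∀ i, 0 < ρ i) (hρ_sum : ∑ i, ρ i = 1)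
    (hrank : P.rank = d)
    (ν μ : Matrix (Fin K) (Fin d) ℝ) (hνμ : ν * μ.transpose = P)
    (α β γ : ℝ) (hα : 0 < α) (hβ : 0 < β) (hγ : 0 < γ)
    (hαν : ∀ x : ℝ, Module.End.HasEigenvalue (Matrix.toLin' (ν.transpose * ν)) x → α < x)
    (hαμ : ∀ x : ℝ, Module.End.HasEigenvalue (Matrix.toLin' (μ.transpose * μ)) x → α < x)
    (hβ_sep : ∀ i j, i ≠ j → β < l2dist (ν i) (ν j) ∨ β < l2dist (μ i) (μ j))
    (hγρ : ∀ i, γ < ρ i)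
    (τ : (n : ℕ) → Ω → Fin n → Fin K) (A : (n : ℕ) → Ω → Matrix (Fin n) (Fin n) ℝ)
    (hSBM : ∀ n, IsDirectedSBM Pr P ρ (τ n) (A n)) :
    ∀ᵐ ω ∂Pr, ∀ᶠ n : ℕ in Filter.atTop,
      ∀ (U V : Matrix (Fin n) (Fin d) ℝ) (τ' : Fin n → Fin K),
        IsUnscaledASE (A n ω) U V → IsMSEClustering (Matrix.fromCols U V) τ' →
          (numMisassigned (τ n ω) τ' : ℝ) ≤
            2 ^ 3 * 3 ^ 2 * 6 / (α ^ 5 * β ^ 2 * γ ^ 5) * Real.log n := by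
  have hlogn : Tendsto (fun n : ℕ => Real.log n / n) atTop (nhds 0) := by
    have := (Real.isLittleO_log_id_atTop.tendsto_div_nhds_zero).comp
      (tendsto_natCast_atTop_atTop (R := ℝ))
    exact this
  have hsmall : ∀ c > 0, ∀ᶠ n : ℕ in atTop, 0 < n ∧ Real.log n < c * n := by
    intro c hc
    filter_upwards [hlogn.eventually (gt_mem_nhds hc), eventually_gt_atTop 0] with n h1 h2
    exact ⟨h2, (div_lt_iff₀ (Nat.cast_pos.2 h2)).1 h1⟩
  set C := 2 ^ 3 * 3 ^ 2 * 6 / (α ^ 5 * β ^ 2 * γ ^ 5) with hC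
  have hC0 : 0 < C := by positivity
  filter_upwards [ae_eventually_le_card_block hSBM (fun i => (hρ i).le) hγρ,
    ae_eventually_frobSq_gram_sub_le hSBM hP,
    ae_eventually_frobSq_gram_sub_le (fun n => (hSBM n).transpose) fun i j => hP j i]
    with ω h1 h2 h3
  -- The first threshold makes `C log n` smaller than every block; the second makes `√(3 n³ log n)`
  -- at most `3 / 16 * (α * γ * n) ^ 2`.
  filter_upwards [h1, h2, h3, hsmall (γ / C) (by positivity),
    hsmall ((3 / 16 * (α * γ) ^ 2) ^ 2 / 3) (by positivity)] with n hblock hE hE' hlogC hloge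
  intro U V τ' hUV hτ'
  obtain ⟨hn, hlogC⟩ := hlogC
  have hn' : (0 : ℝ) < n := Nat.cast_pos.2 hn
  have hlog : 0 ≤ Real.log n := Real.log_natCast_nonneg n
  have hsq : √(3 * n ^ 3 * Real.log n) ^ 2 = 3 * n ^ 3 * Real.log n :=
    Real.sq_sqrt (by positivity)
  refine numMisassigned_le_of_gram_near hP hνμ hα hβ hγ
    (le_l2norm_mulVec_of_eigenvalue ν hαν) (le_l2norm_mulVec_of_eigenvalue μ hαμ) hβ_sep hn hblock
    (Real.sqrt_nonneg (3 * n ^ 3 * Real.log n)) (by rwa [hsq]) (by rwa [hsq]) ?_ ?_ ?_ hUV hτ'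
  · apply le_of_sq_le_sq _ (by positivity)
    rw [hsq]
    calc 3 * (n : ℝ) ^ 3 * Real.log n
        ≤ 3 * (n : ℝ) ^ 3 * ((3 / 16 * (α * γ) ^ 2) ^ 2 / 3 * n) := by gcongr; exact hloge.2.le
      _ = _ := by ring
  · calc C * Real.log n < C * (γ / C * n) := by gcongr
      _ = γ * n := by field_simp
  -- After cancellation the claim is `512 / 3 ≤ 243`, where `243 = 432 * 9 / 16`.
  · rw [div_pow, hsq]
    have hl : 16 * (2 * (3 * (n : ℝ) ^ 3 * Real.log n / (3 / 4 * (α * γ * n) ^ 2) ^ 2))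
        = 512 / 3 * (Real.log n / (α ^ 4 * γ ^ 4 * n)) := by
      field_simp; norm_num; ring
    have hr : C * Real.log n * (9 / 16 * (α * γ * β ^ 2 / n))
        = 243 * (Real.log n / (α ^ 4 * γ ^ 4 * n)) := by
      rw [hC]; field_simp; norm_num; ring
    rw [hl, hr]
    gcongr
    norm_num
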